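/- Let $(X_n)_{n\ge 0}$ be a Galton--Watson process with immigration, that is, $$X_n=\sum_{i=1}^{X_{n-1}}\xi_{n,i}+\varepsilon_n,\qquad n\ge 1,$$ where $\{X_0,\ \xi_{n,i},\ \varepsilon_n : n,i\ge 1\}$ are independent non-negative integer-valued random variables on a probability space $(\Omega,\mathcal A,\mathbb P)$, the variables $\xi_{n,i}$, $n,i\ge 1$, are identically distributed, and the variables $\varepsilon_n$, $n\ge 1$, are identically distributed (empty sums are $0$). Write $\xi:=\xi_{1,1}$, $\varepsilon:=\varepsilon_1$ and $m_\xi:=\mathbb E(\xi)$. A non-negative random variable $Z$ is called regularly varying with index $\alpha\ge 0$ if $\mathbb P(Z>x)>0$ for all $x>0$ and $\lim_{x\to\infty}\mathbb P(Z>qx)/\mathbb P(Z>x)=q^{-\alpha}$ for all $q>0$; and $f(x)\sim g(x)$ as $x\to\infty$ means $\lim_{x\to\infty}f(x)/g(x)=1$. Suppose that $X_0$ and $\varepsilon$ are regularly varying with the same index $\gamma\ge 0$, that $\mathbb P(\xi=0)<1$, and that $\mathbb E(\xi^r)<\infty$ for some $r>\max(1,\gamma)$. Then for each integer $n\ge 1$,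 $$\mathbb P(X_n>x)\ \sim\ m_\xi^{n\gamma}\,\mathbb P(X_0>x)+\sum_{i=1}^n m_\xi^{(n-i)\gamma}\,\mathbb P(\varepsilon>x)\qquad\text{as } x\to\infty,$$ and hence $X_n$ is also regularly varying with index $\gamma$. -/

import Mathlib

open MeasureTheory ProbabilityTheory Filter Topology

/-- A function `U : (0, ∞) → (0, ∞)`, given as the restriction to `(0, ∞)` of a function on `ℝ`,
is measurable and regularly varying at infinity with index `ρ`. -/
structure RegularlyVaryingAtInfinity (U : ℝ → ℝ) (ρ : ℝ) : Prop where
  measurable : Measurable (fun x : Set.Ioi (0 : ℝ) => U x)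
  pos : ∀ x : ℝ, 0 < x → 0 < U x
  tendsto : ∀ q : ℝ, 0 < q → Tendsto (fun x : ℝ => U (q * x) / U x) atTop (𝓝 (q ^ ρ))

/-- The tail function `x ↦ P(Z > x)` of a real random variable `Z`. -/
noncomputable def tailProb {Ω : Type*} [MeasurableSpace Ω] (P : Measure Ω) (Z : Ω → ℝ)
    (x : ℝ) : ℝ :=
  P.real {ω | x < Z ω}

/-- `Z` is a non-negative random variable that is regularly varying with index `α ≥ 0`. -/
structure IsRegularlyVaryingRV {Ω : Type*} [MeasurableSpace Ω] (P : Measure Ω) (Z : Ω → ℝ)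
    (α : ℝ) : Prop where
  measurable : Measurable Z
  nonneg : ∀ ω, 0 ≤ Z ω
  index_nonneg : 0 ≤ α
  tail : RegularlyVaryingAtInfinity (tailProb P Z) (-α)

/-- Labels of the random variables `X₀`, `ξ_{n,i}`, `ε_n` (`n, i ≥ 1`) that drive a
Galton–Watson process with immigration: `offspring n i` labels `ξ_{n+1,i+1}` and `immigration n`
labels `ε_{n+1}`, for `n, i : ℕ`. -/
inductive GWILabel : Type
  | initial : GWILabel
  | offspring (n i : ℕ) : GWILabel
  | immigration (n : ℕ) : GWILabel

/-- The family `{X₀, ξ_{n,i}, ε_n : n, i ≥ 1}`. -/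
def gwiFamily {Ω : Type*} (X₀ : Ω → ℕ) (ξ : ℕ → ℕ → Ω → ℕ) (ε : ℕ → Ω → ℕ) :
    GWILabel → Ω → ℕ
  | .initial => X₀
  | .offspring n i => ξ (n + 1) (i + 1)
  | .immigration n => ε (n + 1)

/-- `(X_n)_{n ≥ 0}` is the Galton–Watson process with immigration with offspring variables
`ξ_{n,i}` and immigration variables `ε_n`, `n, i ≥ 1`. The values of `ξ` and `ε` at an index `0`
play no role. -/
structure IsGWI {Ω : Type*} [MeasurableSpace Ω] (P : Measure Ω) (X : ℕ → Ω → ℕ)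
    (ξ : ℕ → ℕ → Ω → ℕ) (ε : ℕ → Ω → ℕ) : Prop where
  measurable : ∀ l : GWILabel, Measurable (gwiFamily (X 0) ξ ε l)
  indep : iIndepFun (gwiFamily (X 0) ξ ε) P
  identDistrib_offspring : ∀ n i : ℕ, 1 ≤ n → 1 ≤ i → IdentDistrib (ξ n i) (ξ 1 1) P P
  identDistrib_immigration : ∀ n : ℕ, 1 ≤ n → IdentDistrib (ε n) (ε 1) P P
  recursion : ∀ (n : ℕ), 1 ≤ n → ∀ ω : Ω,
    X n ω = (∑ i ∈ Finset.Icc 1 (X (n - 1) ω), ξ n i ω) + ε n ω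

/-! ### Regularly varying functions: closure properties and a Potter bound. -/

section RegularVariation

/-! The proof is an induction on `n`. Write `X (n + 1)` as S + ε, with S a sum of N = `X n` i.i.d.
offspring variables independent of N. Since the offspring law has a finite moment of order r >
max(1, γ), S is large essentially only when N is: by the law of large numbers S is close to mN, so
P(S > x) ~ P(N > x/m) ~ m^γ P(N > x) (`tendsto_tailProb_randomSum`). For independent summands of the
same index the tails add, because both being large is negligible
(`IsRegularlyVaryingRV.tendsto_tailProb_add`). Hence the tail of each generation is asymptotically
m^γ times the previous tail plus the tail of ε, and this recursion unrolls to the stated sum.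

The hard half is the upper bound for S. With c = (1 - δ)/m, S > x forces N > cx, or N ≤ cx with a
summand above ηx, or a sum of ⌊cx⌋ summands truncated at ηx to reach x. The first event gives the
main term. The second is handled by a union bound, Markov's inequality and a Potter bound
(`tendsto_measureReal_exists_lt_div`), the third by a Chernoff bound
(`tendsto_measureReal_le_sum_min_div`). -/

theorem min_div_le_add_div_add {a b c d : ℝ} (hb : 0 < b) (hd : 0 < d) :
    min (a / b) (c / d) ≤ (a + c) / (b + d) := by
  rw [le_div_iff₀ (by positivity), mul_add]
  have h1 := mul_le_mul_of_nonneg_right (min_le_left (a / b) (c / d)) hb.le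
  have h2 := mul_le_mul_of_nonneg_right (min_le_right (a / b) (c / d)) hd.le
  rw [div_mul_cancel₀ _ hb.ne'] at h1
  rw [div_mul_cancel₀ _ hd.ne'] at h2
  linarith

theorem add_div_add_le_max {a b c d : ℝ} (hb : 0 < b) (hd : 0 < d) :
    (a + c) / (b + d) ≤ max (a / b) (c / d) := by
  rw [div_le_iff₀ (by positivity), mul_add]
  have h1 := mul_le_mul_of_nonneg_right (le_max_left (a / b) (c / d)) hb.le
  have h2 := mul_le_mul_of_nonneg_right (le_max_right (a / b) (c / d)) hd.le
  rw [div_mul_cancel₀ _ hb.ne'] at h1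
  rw [div_mul_cancel₀ _ hd.ne'] at h2
  linarith

/-- A mediant lies between the two fractions, so no comparison between `F` and `G` is needed. -/
theorem tendsto_add_div_add {ι : Type*} {l : Filter ι} {f F g G : ι → ℝ} {L : ℝ}
    (hF : ∀ᶠ x in l, 0 < F x) (hG : ∀ᶠ x in l, 0 < G x)
    (hf : Tendsto (fun x => f x / F x) l (𝓝 L)) (hg : Tendsto (fun x => g x / G x) l (𝓝 L)) :
    Tendsto (fun x => (f x + g x) / (F x + G x)) l (𝓝 L) := by
  have h1 := hf.min hg
  have h2 := hf.max hg
  rw [min_self] at h1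
  rw [max_self] at h2
  refine tendsto_of_tendsto_of_tendsto_of_le_of_le' h1 h2 ?_ ?_
  · filter_upwards [hF, hG] with x hx hy using min_div_le_add_div_add hx hy
  · filter_upwards [hF, hG] with x hx hy using add_div_add_le_max hx hy

theorem tendsto_div_trans {ι : Type*} {l : Filter ι} {f g h : ι → ℝ} {a b : ℝ}
    (hg : ∀ᶠ x in l, 0 < g x)
    (h1 : Tendsto (fun x => f x / g x) l (𝓝 a)) (h2 : Tendsto (fun x => g x / h x) l (𝓝 b)) :
    Tendsto (fun x => f x / h x) l (𝓝 (a * b)) := by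
  refine (h1.mul h2).congr' ?_
  filter_upwards [hg] with x hx
  rw [div_mul_div_cancel₀ hx.ne']

theorem RegularlyVaryingAtInfinity.eventually_pos {U : ℝ → ℝ} {ρ : ℝ}
    (hU : RegularlyVaryingAtInfinity U ρ) : ∀ᶠ x in atTop, 0 < U x :=
  (eventually_gt_atTop 0).mono hU.pos

theorem RegularlyVaryingAtInfinity.const_mul {U : ℝ → ℝ} {ρ c : ℝ}
    (hU : RegularlyVaryingAtInfinity U ρ) (hc : 0 < c) :
    RegularlyVaryingAtInfinity (fun x => c * U x) ρ where
  measurable := hU.measurable.const_mul c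
  pos x hx := mul_pos hc (hU.pos x hx)
  tendsto q hq := by simpa [mul_div_mul_left _ _ hc.ne'] using hU.tendsto q hq

theorem RegularlyVaryingAtInfinity.add {U V : ℝ → ℝ} {ρ : ℝ}
    (hU : RegularlyVaryingAtInfinity U ρ) (hV : RegularlyVaryingAtInfinity V ρ) :
    RegularlyVaryingAtInfinity (fun x => U x + V x) ρ where
  measurable := hU.measurable.add hV.measurable
  pos x hx := add_pos (hU.pos x hx) (hV.pos x hx)
  tendsto q hq :=
    tendsto_add_div_add hU.eventually_pos hV.eventually_pos (hU.tendsto q hq) (hV.tendsto q hq)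

theorem RegularlyVaryingAtInfinity.of_tendsto_div {U V : ℝ → ℝ} {ρ : ℝ}
    (hU : RegularlyVaryingAtInfinity U ρ) (hm : Measurable (fun x : Set.Ioi (0 : ℝ) => V x))
    (hpos : ∀ x, 0 < x → 0 < V x) (h : Tendsto (fun x => V x / U x) atTop (𝓝 1)) :
    RegularlyVaryingAtInfinity V ρ where
  measurable := hm
  pos := hpos
  tendsto q hq := by
    have hq' : Tendsto (fun x : ℝ => q * x) atTop atTop := tendsto_id.const_mul_atTop hq
    have h1 := h.comp hq'
    have h2 : Tendsto (fun x => U x / V x) atTop (𝓝 1) := by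
      simpa using h.inv₀ one_ne_zero
    have h3 := tendsto_div_trans (f := fun x => V (q * x)) (g := fun x => U (q * x))
      (hq'.eventually hU.eventually_pos) h1 (hU.tendsto q hq)
    have h4 := tendsto_div_trans hU.eventually_pos h3 h2
    simpa using h4

/-- A Potter-type bound for nonincreasing regularly varying functions. -/
theorem RegularlyVaryingAtInfinity.exists_potter_bound {F : ℝ → ℝ} {γ ρ : ℝ}
    (hF : RegularlyVaryingAtInfinity F (-γ)) (hanti : Antitone F) (hone : ∀ x, F x ≤ 1)
    (hρ0 : 0 < ρ) (hρ : γ < ρ) :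
    ∃ C > 0, ∃ x₀ ≥ 1, ∀ x y : ℝ, 0 < x → x₀ ≤ y → x ≤ y → F x * x ^ ρ ≤ C * (F y * y ^ ρ) := by
  -- The gap γ < ρ absorbs the error in the limit 2^(-γ), leaving an inequality that can be iterated
  -- along doublings.
  have h2 : ∀ᶠ x in atTop, (2 : ℝ) ^ (-ρ) < F (2 * x) / F x :=
    (hF.tendsto 2 two_pos).eventually_const_lt
      (Real.rpow_lt_rpow_of_exponent_lt one_lt_two (by linarith))
  obtain ⟨x₁, hx₁⟩ := eventually_atTop.1 h2
  set x₀ := max x₁ 1 with hx₀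
  have hx₀1 : 1 ≤ x₀ := le_max_right _ _
  have hdouble : ∀ x, x₀ ≤ x → F x ≤ 2 ^ ρ * F (2 * x) := by
    intro x hx
    have h := hx₁ x ((le_max_left _ _).trans hx)
    rw [lt_div_iff₀ (hF.pos x (by linarith)), Real.rpow_neg two_pos.le, inv_mul_lt_iff₀
      (by positivity)] at h
    exact h.le
  have hpow : ∀ k : ℕ, ∀ x, x₀ ≤ x → F x ≤ (2 ^ ρ) ^ k * F (2 ^ k * x) := by
    intro k
    induction k with
    | zero => intro x _; simp
    | succ k ih =>
      intro x hx
      have h1 : x₀ ≤ 2 ^ k * x := by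
        nlinarith [one_le_pow₀ (n := k) (one_le_two : (1 : ℝ) ≤ 2)]
      calc F x ≤ (2 ^ ρ) ^ k * F (2 ^ k * x) := ih x hx
        _ ≤ (2 ^ ρ) ^ k * (2 ^ ρ * F (2 * (2 ^ k * x))) := by
          gcongr; exact hdouble _ h1
        _ = (2 ^ ρ) ^ (k + 1) * F (2 ^ (k + 1) * x) := by
          rw [← mul_assoc 2, ← pow_succ', ← mul_assoc, ← pow_succ]
  have hlarge : ∀ x y, x₀ ≤ x → x ≤ y → F x * x ^ ρ ≤ 2 ^ ρ * (F y * y ^ ρ) := by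
    intro x y hx hxy
    have hx0 : 0 < x := by linarith
    -- With 2^k x ≤ y < 2^(k+1) x, the upper end bounds `F` by monotonicity and the lower end bounds
    -- the power; the mismatch costs one factor 2^ρ.
    obtain ⟨k, hk1, hk2⟩ := exists_nat_pow_near ((one_le_div hx0).2 hxy)
      (one_lt_two : (1 : ℝ) < 2)
    rw [le_div_iff₀ hx0] at hk1
    rw [div_lt_iff₀ hx0] at hk2
    calc F x * x ^ ρ ≤ ((2 ^ ρ) ^ (k + 1) * F (2 ^ (k + 1) * x)) * x ^ ρ := by
          gcongr; exact hpow _ _ hx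
      _ ≤ ((2 ^ ρ) ^ (k + 1) * F y) * x ^ ρ := by
          gcongr; exact hanti hk2.le
      _ = 2 ^ ρ * (F y * ((2 ^ k) * x) ^ ρ) := by
          rw [Real.mul_rpow (by positivity) hx0.le, ← Real.rpow_natCast_mul two_pos.le,
            mul_comm (k : ℝ), Real.rpow_mul_natCast two_pos.le]
          ring
      _ ≤ 2 ^ ρ * (F y * y ^ ρ) := by
          have := hF.pos y (by linarith)
          gcongr
  have hFx₀ : 0 < F x₀ := hF.pos _ (by linarith)
  refine ⟨2 ^ ρ / F x₀, by positivity, x₀, hx₀1, fun x y hx hy hxy => ?_⟩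
  have hFy : 0 < F y := hF.pos y (by linarith)
  have hy0 : 0 < y := by linarith
  rcases le_total x₀ x with h | h
  · refine (hlarge x y h hxy).trans ?_
    have : (2 : ℝ) ^ ρ ≤ 2 ^ ρ / F x₀ := le_div_self (by positivity) hFx₀ (hone _)
    gcongr
  -- Below x₀ only `F` ≤ 1 is available, whence the factor 1 / F x₀ in the constant.
  · calc F x * x ^ ρ ≤ 1 * x₀ ^ ρ := by gcongr; exact hone _
      _ = (F x₀ * x₀ ^ ρ) / F x₀ := by field_simp
      _ ≤ (2 ^ ρ * (F y * y ^ ρ)) / F x₀ := by exact div_le_div_of_nonneg_right (hlarge _ _ le_rfl hy) hFx₀.le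
      _ = _ := by ring

end RegularVariation

/-! ### Tail functions and sums of two independent variables. -/

section Tail

variable {Ω : Type*} [MeasurableSpace Ω] {P : Measure Ω} {Z : Ω → ℝ}

theorem tailProb_nonneg (x : ℝ) : 0 ≤ tailProb P Z x := measureReal_nonneg

variable [IsProbabilityMeasure P]

theorem tailProb_le_one (x : ℝ) : tailProb P Z x ≤ 1 := measureReal_le_one

theorem tailProb_antitone : Antitone (tailProb P Z) := fun _ _ h =>
  measureReal_mono fun _ hω => h.trans_lt hω

theorem measurable_tailProb_restrict : Measurable (fun x : Set.Ioi (0 : ℝ) => tailProb P Z x) :=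
  tailProb_antitone.measurable.comp measurable_subtype_coe

theorem tendsto_tailProb_atTop (hZ : Measurable Z) : Tendsto (tailProb P Z) atTop (𝓝 0) := by
  have : IsProbabilityMeasure (P.map Z) := Measure.isProbabilityMeasure_map hZ.aemeasurable
  have h := (tendsto_cdf_atTop (P.map Z)).const_sub 1
  rw [sub_self] at h
  refine h.congr fun x => ?_
  rw [cdf_eq_real, map_measureReal_apply hZ measurableSet_Iic,
    ← probReal_compl_eq_one_sub (hZ measurableSet_Iic)]
  congr 1
  ext ω
  simp

/-- Positivity at large arguments propagates downwards by monotonicity. -/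
theorem tailProb_pos_of_tendsto_div {U : ℝ → ℝ} {c : ℝ} (hc : 0 < c)
    (hU : ∀ᶠ x in atTop, 0 < U x)
    (h : Tendsto (fun x => tailProb P Z x / U x) atTop (𝓝 c)) (x : ℝ) : 0 < tailProb P Z x := by
  obtain ⟨y, hy1, hy2, hy3⟩ :=
    ((h.eventually_const_lt hc).and (hU.and (eventually_ge_atTop x))).exists
  exact ((div_pos_iff_of_pos_right hy2).1 hy1).trans_le (tailProb_antitone hy3)

theorem IsRegularlyVaryingRV.of_tendsto_div {U : ℝ → ℝ} {γ : ℝ} (hγ : 0 ≤ γ) (hZ : Measurable Z)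
    (hZ0 : ∀ ω, 0 ≤ Z ω) (hU : RegularlyVaryingAtInfinity U (-γ))
    (h : Tendsto (fun x => tailProb P Z x / U x) atTop (𝓝 1)) : IsRegularlyVaryingRV P Z γ where
  measurable := hZ
  nonneg := hZ0
  index_nonneg := hγ
  tail := hU.of_tendsto_div measurable_tailProb_restrict
    (fun x _ => tailProb_pos_of_tendsto_div one_pos hU.eventually_pos h x) h

/-- Tail of a sum of two independent regularly varying random variables with a common index. -/
theorem IsRegularlyVaryingRV.tendsto_tailProb_add {A B : Ω → ℝ} {γ : ℝ}
    (hA : IsRegularlyVaryingRV P A γ) (hB : IsRegularlyVaryingRV P B γ) (hAB : IndepFun A B P) :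
    Tendsto (fun x => tailProb P (fun ω => A ω + B ω) x / (tailProb P A x + tailProb P B x))
      atTop (𝓝 1) := by
  have hmul : ∀ x, P.real ({ω | x < A ω} ∩ {ω | x < B ω}) = tailProb P A x * tailProb P B x := by
    intro x
    simp only [measureReal_def, tailProb, ← ENNReal.toReal_mul]
    congr 1
    exact hAB.measure_inter_preimage_eq_mul (Set.Ioi x) (Set.Ioi x)
      measurableSet_Ioi measurableSet_Ioi
  have hmeas : ∀ x, MeasurableSet {ω | x < B ω} := fun x => hB.measurable measurableSet_Ioi
  rw [tendsto_order]
  constructor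
  · intro b hb
    have h1 : Tendsto (fun x => 1 - tailProb P B x) atTop (𝓝 1) := by
      simpa using (tendsto_tailProb_atTop (P := P) hB.measurable).const_sub 1
    filter_upwards [h1.eventually_const_lt hb, eventually_gt_atTop 0] with x hx hx0
    refine hx.trans_le ?_
    have hAp := hA.tail.pos x hx0
    have hBp := hB.tail.pos x hx0
    rw [le_div_iff₀ (by positivity)]
    have h2 := measureReal_union_add_inter (μ := P) (s := {ω | x < A ω}) (hmeas x)
    rw [hmul] at h2
    have h3 : P.real ({ω | x < A ω} ∪ {ω | x < B ω}) ≤ tailProb P (fun ω => A ω + B ω) x := by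
      refine measureReal_mono ?_
      rintro ω (h | h)
      · exact lt_of_lt_of_le (b := A ω) h (le_add_of_nonneg_right (hB.nonneg ω))
      · exact lt_of_lt_of_le (b := B ω) h (le_add_of_nonneg_left (hA.nonneg ω))
    have h4 : P.real {ω | x < A ω} = tailProb P A x := rfl
    have h5 : P.real {ω | x < B ω} = tailProb P B x := rfl
    -- With a, b the two tails, inclusion–exclusion gives a + b - ab ≥ (1 - b)(a + b), the
    -- difference being b².
    nlinarith [mul_pos hBp hBp]
  · intro b hb
    have hcont : Tendsto (fun δ : ℝ => (1 - δ) ^ (-γ)) (𝓝[>] 0) (𝓝 1) := by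
      have : ContinuousAt (fun δ : ℝ => (1 - δ) ^ (-γ)) 0 :=
        ContinuousAt.rpow_const (by fun_prop) (by norm_num)
      simpa [ContinuousAt] using this.tendsto.mono_left (nhdsWithin_le_nhds (s := Set.Ioi 0))
    obtain ⟨δ, hδb, hδ0, hδ1⟩ := ((hcont.eventually_lt_const hb).and
      (Ioo_mem_nhdsGT (one_pos : (0 : ℝ) < 1))).exists
    have h1 := (hA.tail.add hB.tail).tendsto (1 - δ) (by linarith)
    have h2 : Tendsto (fun x => tailProb P A (δ * x) / tailProb P A x * tailProb P B (δ * x))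
        atTop (𝓝 0) := by
      have := (hA.tail.tendsto δ hδ0).mul ((tendsto_tailProb_atTop (P := P) hB.measurable).comp
        (tendsto_id.const_mul_atTop hδ0))
      simpa using this
    have h3 := h1.add h2
    rw [add_zero] at h3
    filter_upwards [h3.eventually_lt_const hδb, eventually_gt_atTop 0] with x hx hx0
    refine lt_of_le_of_lt ?_ hx
    have hAp := hA.tail.pos x hx0
    have hBp := hB.tail.pos x hx0
    -- Either one summand almost reaches x alone, or both exceed δx; by independence the latter has
    -- probability o(P(A > x)).
    have hsub : {ω | x < A ω + B ω} ⊆ ({ω | (1 - δ) * x < A ω} ∪ {ω | (1 - δ) * x < B ω}) ∪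
        ({ω | δ * x < A ω} ∩ {ω | δ * x < B ω}) := by
      intro ω hω
      simp only [Set.mem_ofPred_eq, Set.mem_union, Set.mem_inter_iff] at hω ⊢
      by_contra! hcon
      obtain ⟨⟨c1, c2⟩, c3⟩ := hcon
      by_cases c4 : δ * x < A ω
      · linarith [c3 c4]
      · linarith
    have h4 : tailProb P (fun ω => A ω + B ω) x ≤ tailProb P A ((1 - δ) * x) +
        tailProb P B ((1 - δ) * x) + tailProb P A (δ * x) * tailProb P B (δ * x) := by
      rw [← hmul]
      refine (measureReal_mono hsub).trans ((measureReal_union_le _ _).trans ?_)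
      gcongr
      exact measureReal_union_le _ _
    calc _ ≤ (tailProb P A ((1 - δ) * x) +
        tailProb P B ((1 - δ) * x) + tailProb P A (δ * x) * tailProb P B (δ * x)) /
          (tailProb P A x + tailProb P B x) := by gcongr
      _ = (tailProb P A ((1 - δ) * x) + tailProb P B ((1 - δ) * x)) /
          (tailProb P A x + tailProb P B x) + tailProb P A (δ * x) * tailProb P B (δ * x) /
          (tailProb P A x + tailProb P B x) := add_div _ _ _
      _ ≤ _ := by
        rw [div_mul_eq_mul_div]
        have := tailProb_nonneg (P := P) (Z := A) (δ * x)
        have := tailProb_nonneg (P := P) (Z := B) (δ * x)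
        gcongr
        linarith

end Tail

/-! ### Moment, Chernoff and union bounds for sums of i.i.d. variables. -/

section RandomSum

/-- Replaces the second-order Taylor bound when only a moment of order p ≤ 2 is finite. For u ≤ 1 it
follows from u² ≤ u^p, for u ≥ 1 from u^p ≥ 1. -/
theorem Real.exp_le_one_add_add_rpow_mul_exp {u p : ℝ} (hu : 0 ≤ u) (hp1 : 0 ≤ p) (hp2 : p ≤ 2) :
    Real.exp u ≤ 1 + u + u ^ p * Real.exp u := by
  have he : Real.exp u - 1 ≤ u * Real.exp u := by
    have h1 := Real.add_one_le_exp (-u)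
    have h2 : Real.exp (-u) * Real.exp u = 1 := by rw [← Real.exp_add]; simp
    nlinarith [Real.exp_pos u]
  have h0 := Real.exp_pos u
  rcases le_total u 1 with h | h
  · have h3 : u ^ (2 : ℝ) ≤ u ^ p :=
      Real.rpow_le_rpow_of_exponent_ge' hu h hp1 hp2
    rw [Real.rpow_two] at h3
    nlinarith
  · have h3 : 1 ≤ u ^ p := Real.one_le_rpow h hp1
    nlinarith

variable {Ω : Type*} [MeasurableSpace Ω] {P : Measure Ω} [IsProbabilityMeasure P]

theorem integrable_rpow_of_le {Z : Ω → ℝ} {p r : ℝ} (hZ : Measurable Z) (hZ0 : ∀ ω, 0 ≤ Z ω)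
    (hp : 0 ≤ p) (hpr : p ≤ r) (hr : Integrable (fun ω => Z ω ^ r) P) :
    Integrable (fun ω => Z ω ^ p) P := by
  refine ((integrable_const (1 : ℝ)).add hr).mono' (hZ.pow_const p).aestronglyMeasurable
    (ae_of_all _ fun ω => ?_)
  rw [Real.norm_of_nonneg (Real.rpow_nonneg (hZ0 ω) _)]
  simp only [Pi.add_apply]
  rcases le_total (Z ω) 1 with h | h
  · linarith [Real.rpow_le_one (hZ0 ω) h hp, Real.rpow_nonneg (hZ0 ω) r]
  · linarith [Real.rpow_le_rpow_of_exponent_le h hpr]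

theorem tailProb_le_integral_rpow {Z : Ω → ℝ} {r T : ℝ} (hZ0 : ∀ ω, 0 ≤ Z ω) (hr0 : 0 ≤ r)
    (hr : Integrable (fun ω => Z ω ^ r) P) (hT : 0 < T) :
    tailProb P Z T ≤ (∫ ω, Z ω ^ r ∂P) * T ^ (-r) := by
  have h1 := mul_meas_ge_le_integral_of_nonneg
    (ae_of_all P fun ω => Real.rpow_nonneg (hZ0 ω) r) hr (T ^ r)
  have h2 : tailProb P Z T ≤ P.real {ω | T ^ r ≤ Z ω ^ r} :=
    measureReal_mono fun ω hω => Real.rpow_le_rpow hT.le (le_of_lt hω) hr0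
  have h3 : 0 < T ^ r := Real.rpow_pos_of_pos hT r
  rw [Real.rpow_neg hT.le, ← div_eq_mul_inv, le_div_iff₀ h3, mul_comm]
  exact (mul_le_mul_of_nonneg_left h2 h3.le).trans h1

variable {Y : ℕ → Ω → ℝ} {N : Ω → ℕ}

/-- Chernoff bound for sums of truncated nonnegative random variables. -/
theorem measureReal_le_sum_min_le (hYm : ∀ i, Measurable (Y i)) (hY0 : ∀ i ω, 0 ≤ Y i ω)
    (hYi : iIndepFun Y P) (hYd : ∀ i, IdentDistrib (Y i) (Y 0) P P) {p l T : ℝ}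
    (hp0 : 0 ≤ p) (hp2 : p ≤ 2) (hint : Integrable (Y 0) P)
    (hintp : Integrable (fun ω => Y 0 ω ^ p) P) (hl : 0 ≤ l) (hT : 0 ≤ T) (K : ℕ) (x : ℝ) :
    P.real {ω | x ≤ ∑ i ∈ Finset.range K, min (Y i ω) T} ≤
      Real.exp (-(l * x) + K * (l * (∫ ω, Y 0 ω ∂P) +
        l ^ p * (∫ ω, Y 0 ω ^ p ∂P) * Real.exp (l * T))) := by
  set Z : ℕ → Ω → ℝ := fun i ω => min (Y i ω) T with hZ
  have hmin : Measurable fun y : ℝ => min y T := by fun_prop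
  have hZm : ∀ i, Measurable (Z i) := fun i => hmin.comp (hYm i)
  have hZi : iIndepFun Z P := hYi.comp (fun _ y => min y T) fun _ => hmin
  have hZd : ∀ i, IdentDistrib (Z i) (Z 0) P P := fun i => (hYd i).comp hmin
  have hZint : ∀ i, Integrable (fun ω => Real.exp (l * Z i ω)) P := by
    intro i
    refine Integrable.of_bound (by fun_prop) (Real.exp (l * T)) (ae_of_all _ fun ω => ?_)
    rw [Real.norm_of_nonneg (Real.exp_pos _).le]
    gcongr
    exact min_le_right _ _
  have hmgf : mgf (Z 0) P l ≤ Real.exp (l * (∫ ω, Y 0 ω ∂P) +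
        l ^ p * (∫ ω, Y 0 ω ^ p ∂P) * Real.exp (l * T)) := by
    have hb : ∀ ω, Real.exp (l * Z 0 ω) ≤
        1 + l * Y 0 ω + l ^ p * Y 0 ω ^ p * Real.exp (l * T) := by
      intro ω
      have hz0 : 0 ≤ Z 0 ω := le_min (hY0 0 ω) hT
      have hzY : Z 0 ω ≤ Y 0 ω := min_le_left _ _
      have hzT : Z 0 ω ≤ T := min_le_right _ _
      refine (Real.exp_le_one_add_add_rpow_mul_exp (mul_nonneg hl hz0) hp0 hp2).trans ?_
      rw [Real.mul_rpow hl hz0]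
      have h0 := mul_nonneg (Real.rpow_nonneg hl p) (Real.rpow_nonneg (hY0 0 ω) p)
      gcongr
    have h1 : Integrable (fun ω => 1 + l * Y 0 ω) P :=
      (integrable_const _).add (hint.const_mul l)
    have h2 : Integrable (fun ω => l ^ p * Y 0 ω ^ p * Real.exp (l * T)) P :=
      (hintp.const_mul _).mul_const _
    calc mgf (Z 0) P l ≤ ∫ ω, (1 + l * Y 0 ω + l ^ p * Y 0 ω ^ p * Real.exp (l * T)) ∂P :=
          integral_mono (hZint 0) (h1.add h2) hb
      _ = (l * (∫ ω, Y 0 ω ∂P) + l ^ p * (∫ ω, Y 0 ω ^ p ∂P) * Real.exp (l * T)) + 1 := by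
          rw [integral_add h1 h2, integral_add (integrable_const _) (hint.const_mul l),
            integral_mul_const, integral_const_mul, integral_const_mul]
          simp
          ring
      _ ≤ _ := Real.add_one_le_exp _
  have hset : {ω | x ≤ ∑ i ∈ Finset.range K, min (Y i ω) T} =
      {ω | x ≤ (∑ i ∈ Finset.range K, Z i) ω} := by
    ext ω; simp [hZ]
  rw [hset]
  refine (measure_ge_le_exp_mul_mgf x hl
    (hZi.integrable_exp_mul_sum hZm fun i _ => hZint i)).trans ?_
  rw [hZi.mgf_sum hZm, Finset.prod_congr rfl fun i _ => congrFun (mgf_congr_identDistrib (hZd i)) l,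
    Finset.prod_const, Finset.card_range, Real.exp_add, Real.exp_nat_mul, neg_mul]
  gcongr
  exact mgf_nonneg

/-- Union bound for the event that one of the first `N` summands is large. -/
theorem measureReal_exists_lt_le
    (hYd : ∀ i, IdentDistrib (Y i) (Y 0) P P) (hNY : IndepFun N (fun ω i => Y i ω) P) (y T : ℝ) :
    P.real {ω | (N ω : ℝ) ≤ y ∧ ∃ i < N ω, T < Y i ω} ≤
      (∑ i ∈ Finset.range ⌊y⌋₊, tailProb P (fun ω => (N ω : ℝ)) i) * tailProb P (Y 0) T := by
  have hsub : {ω | (N ω : ℝ) ≤ y ∧ ∃ i < N ω, T < Y i ω} ⊆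
      ⋃ i ∈ Finset.range ⌊y⌋₊, ({ω | (i : ℝ) < N ω} ∩ {ω | T < Y i ω}) := by
    rintro ω ⟨h1, i, h2, h3⟩
    simp only [Set.mem_iUnion, Finset.mem_range]
    exact ⟨i, h2.trans_le (Nat.le_floor h1), by simpa using h2, h3⟩
  refine (measureReal_mono hsub (measure_ne_top _ _)).trans ((measureReal_biUnion_finset_le _ _).trans ?_)
  rw [Finset.sum_mul]
  refine Finset.sum_le_sum fun i _ => le_of_eq ?_
  have h1 : IndepFun N (Y i) P := hNY.comp measurable_id (measurable_pi_apply i)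
  have h2 := h1.measure_inter_preimage_eq_mul {k | (i : ℝ) < k} (Set.Ioi T)
    (MeasurableSet.of_discrete) measurableSet_Ioi
  have h3 := (hYd i).measure_mem_eq (measurableSet_Ioi (a := T))
  rw [h3] at h2
  simp only [measureReal_def, tailProb, ← ENNReal.toReal_mul]
  exact congrArg ENNReal.toReal h2

end RandomSum

/-! ### The tail of a random sum. -/

section RandomSumTail

variable {Ω : Type*} [MeasurableSpace Ω] {P : Measure Ω} [IsProbabilityMeasure P]
  {Y : ℕ → Ω → ℝ} {N : Ω → ℕ} {γ r : ℝ}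

/-- Growth of partial sums of a nonincreasing regularly varying function. -/
theorem RegularlyVaryingAtInfinity.exists_sum_range_floor_le {F : ℝ → ℝ} {ρ : ℝ}
    (hF : RegularlyVaryingAtInfinity F (-γ)) (hanti : Antitone F) (hone : ∀ x, F x ≤ 1)
    (hρ1 : 1 < ρ) (hρ : γ < ρ) :
    ∃ C : ℝ, ∀ᶠ y in atTop, ∑ i ∈ Finset.range ⌊y⌋₊, F i ≤ C * (F y * y ^ ρ) := by
  obtain ⟨C, hC, x₀, hx₀, hpot⟩ := hF.exists_potter_bound hanti hone (by linarith) hρ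
  have hs : Summable fun n : ℕ => 1 / (n : ℝ) ^ ρ := Real.summable_one_div_nat_rpow.2 hρ1
  have hF1 := hF.pos 1 one_pos
  refine ⟨C / F 1 + C * ∑' n : ℕ, 1 / (n : ℝ) ^ ρ, ?_⟩
  filter_upwards [eventually_ge_atTop x₀] with y hy
  have hy1 : 1 ≤ y := hx₀.trans hy
  have hFy := hF.pos y (by linarith)
  have h1 : F 1 ≤ C * (F y * y ^ ρ) := by simpa using hpot 1 y one_pos hy hy1
  have hW : 0 ≤ C * (F y * y ^ ρ) := by positivity
  have hterm : ∀ i ∈ Finset.range ⌊y⌋₊, F i ≤ (if i = 0 then C * (F y * y ^ ρ) / F 1 else 0) +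
      C * (F y * y ^ ρ) * (1 / (i : ℝ) ^ ρ) := by
    intro i hi
    rcases Nat.eq_zero_or_pos i with rfl | hi0
    -- The Potter bound needs a positive argument and 1 / 0 ^ ρ is 0 here, so the index 0 is paid
    -- for by a separate term.
    · have h2 : 1 ≤ C * (F y * y ^ ρ) / F 1 := (one_le_div hF1).2 h1
      have h3 := hone ((0 : ℕ) : ℝ)
      have h4 : 0 ≤ C * (F y * y ^ ρ) * (1 / ((0 : ℕ) : ℝ) ^ ρ) := by positivity
      rw [if_pos rfl]
      exact h3.trans (h2.trans (le_add_of_nonneg_right h4))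
    · have hi0' : (0 : ℝ) < i := by exact_mod_cast hi0
      have hiy : (i : ℝ) ≤ y :=
        (Nat.le_floor_iff (by linarith)).1 (Finset.mem_range.1 hi).le
      rw [if_neg hi0.ne', zero_add, mul_one_div, le_div_iff₀ (by positivity)]
      exact hpot i y hi0' hy hiy
  refine (Finset.sum_le_sum hterm).trans ?_
  rw [Finset.sum_add_distrib, ← Finset.mul_sum, Finset.sum_ite_eq']
  have h5 : ∑ i ∈ Finset.range ⌊y⌋₊, 1 / (i : ℝ) ^ ρ ≤ ∑' n : ℕ, 1 / (n : ℝ) ^ ρ :=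
    hs.sum_le_tsum _ fun i _ => by positivity
  have h6 : (if 0 ∈ Finset.range ⌊y⌋₊ then C * (F y * y ^ ρ) / F 1 else 0) ≤
      C * (F y * y ^ ρ) / F 1 := by
    split_ifs
    · exact le_rfl
    · positivity
  calc _ ≤ C * (F y * y ^ ρ) / F 1 + C * (F y * y ^ ρ) * ∑' n : ℕ, 1 / (n : ℝ) ^ ρ := by gcongr
    _ = _ := by ring

theorem tendsto_measureReal_exists_lt_div
    (hY0 : ∀ i ω, 0 ≤ Y i ω) (hYd : ∀ i, IdentDistrib (Y i) (Y 0) P P)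
    (hNY : IndepFun N (fun ω i => Y i ω) P)
    (hN : RegularlyVaryingAtInfinity (tailProb P (fun ω => (N ω : ℝ))) (-γ))
    (hr1 : 1 < r) (hrγ : γ < r) (hint : Integrable (fun ω => Y 0 ω ^ r) P)
    {c η : ℝ} (hc : 0 < c) (hη : 0 < η) :
    Tendsto (fun x => P.real {ω | (N ω : ℝ) ≤ c * x ∧ ∃ i < N ω, η * x < Y i ω} /
      tailProb P (fun ω => (N ω : ℝ)) x) atTop (𝓝 0) := by
  set F := tailProb P (fun ω => (N ω : ℝ))
  -- ρ > 1 makes the series of i^(-ρ) converge, ρ > γ allows the Potter bound, and ρ < r leaves the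
  -- decay x^(ρ - r).
  obtain ⟨ρ, hρ, hρr⟩ := exists_between (max_lt hr1 hrγ)
  obtain ⟨hρ1, hργ⟩ := max_lt_iff.1 hρ
  obtain ⟨C, hC⟩ := hN.exists_sum_range_floor_le tailProb_antitone tailProb_le_one hρ1 hργ
  set M := ∫ ω, Y 0 ω ^ r ∂P
  have hM : 0 ≤ M := integral_nonneg fun ω => Real.rpow_nonneg (hY0 0 ω) _
  have hlim : Tendsto (fun x : ℝ => C * c ^ ρ * M * η ^ (-r) * (F (c * x) / F x) * x ^ (-(r - ρ)))
      atTop (𝓝 0) := by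
    have := ((hN.tendsto c hc).const_mul (C * c ^ ρ * M * η ^ (-r))).mul
      (tendsto_rpow_neg_atTop (sub_pos.2 hρr))
    simpa using this
  refine squeeze_zero' (Eventually.of_forall fun x => div_nonneg measureReal_nonneg
    (tailProb_nonneg x)) ?_ hlim
  filter_upwards [(tendsto_id.const_mul_atTop hc).eventually hC, eventually_gt_atTop 0]
    with x hx hx0
  simp only [id] at hx
  have hFx := hN.pos x hx0
  have h1 := measureReal_exists_lt_le hYd hNY (c * x) (η * x)
  have h2 := tailProb_le_integral_rpow (hY0 0) (by linarith) hint (mul_pos hη hx0)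
  have h3 : 0 ≤ ∑ i ∈ Finset.range ⌊c * x⌋₊, F i :=
    Finset.sum_nonneg fun i _ => tailProb_nonneg _
  calc _ ≤ (C * (F (c * x) * (c * x) ^ ρ)) * (M * (η * x) ^ (-r)) / F x := by
        gcongr
        exact h1.trans (mul_le_mul hx h2 (tailProb_nonneg _) (h3.trans hx))
    _ = _ := by
        rw [Real.mul_rpow hc.le hx0.le, Real.mul_rpow hη.le hx0.le,
          show -(r - ρ) = ρ + -r by ring, Real.rpow_add hx0]
        ring

/-- The truncated sum has mean at most (1 - δ)x. Truncating at a small enough multiple of x lets the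
Chernoff bound with parameter of order log x / x beat the polynomial lower bound on `F`. -/
theorem tendsto_measureReal_le_sum_min_div {F : ℝ → ℝ} (hYm : ∀ i, Measurable (Y i))
    (hY0 : ∀ i ω, 0 ≤ Y i ω) (hYi : iIndepFun Y P) (hYd : ∀ i, IdentDistrib (Y i) (Y 0) P P)
    (hF : RegularlyVaryingAtInfinity F (-γ)) (hanti : Antitone F) (hone : ∀ x, F x ≤ 1)
    (hr1 : 1 < r) (hint : Integrable (fun ω => Y 0 ω ^ r) P)
    (hm : 0 < ∫ ω, Y 0 ω ∂P) {δ : ℝ} (hδ0 : 0 < δ) (hδ1 : δ < 1) :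
    ∃ η > 0, Tendsto (fun x => P.real {ω | x ≤
      ∑ i ∈ Finset.range ⌊(1 - δ) / (∫ ω, Y 0 ω ∂P) * x⌋₊, min (Y i ω) (η * x)} / F x)
      atTop (𝓝 0) := by
  set m := ∫ ω, Y 0 ω ∂P
  set p := min r 2
  have hp1 : 1 < p := lt_min hr1 one_lt_two
  have hp2 : p ≤ 2 := min_le_right _ _
  have hintp := integrable_rpow_of_le (hYm 0) (hY0 0) (by linarith) (min_le_left r 2) hint
  have hint1 : Integrable (Y 0) P := by
    simpa using integrable_rpow_of_le (hYm 0) (hY0 0) zero_le_one hr1.le hint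
  set M := ∫ ω, Y 0 ω ^ p ∂P
  have hM : 0 ≤ M := integral_nonneg fun ω => Real.rpow_nonneg (hY0 0 ω) _
  set ρ := max γ 0 + 1 with hρ
  have hρ0 : 0 < ρ := by positivity
  have hργ : γ < ρ := by linarith [le_max_left γ 0]
  -- For l = A log x / x, this A gives δlx = (ρ + 1) log x. Below, s satisfies x^p = x · x^(2s), and
  -- η makes exp(lηx) = x^s, so the p-th moment error is of order (log x)^p / x^s.
  set A := (ρ + 1) / δ with hA
  have hA0 : 0 < A := by positivity
  set s := (p - 1) / 2 with hs
  have hs0 : 0 < s := by linarith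
  set η := s / A with hη
  have hη0 : 0 < η := by positivity
  refine ⟨η, hη0, ?_⟩
  obtain ⟨C, hC, x₀, hx₀, hpot⟩ := hF.exists_potter_bound hanti hone hρ0 hργ
  set B := F x₀ * x₀ ^ ρ / C with hB
  have hB0 : 0 < B := by
    have := hF.pos x₀ (by linarith)
    positivity
  have herr : Tendsto (fun x : ℝ => (1 - δ) / m * A ^ p * M * (Real.log x ^ p / x ^ s)) atTop
      (𝓝 0) := by
    simpa using ((isLittleO_log_rpow_rpow_atTop p hs0).tendsto_div_nhds_zero).const_mul
      ((1 - δ) / m * A ^ p * M)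
  have hlim : Tendsto (fun x : ℝ => Real.exp 1 / B * x ^ (-(1 : ℝ))) atTop (𝓝 0) := by
    simpa using (tendsto_rpow_neg_atTop one_pos).const_mul (Real.exp 1 / B)
  refine squeeze_zero' ((eventually_gt_atTop 0).mono fun x hx => div_nonneg measureReal_nonneg
    (hF.pos x hx).le) ?_ hlim
  filter_upwards [herr.eventually_lt_const one_pos, eventually_ge_atTop x₀,
    eventually_gt_atTop 1] with x hx1 hx2 hx3
  have hx0 : 0 < x := by linarith
  have hlog : 0 < Real.log x := Real.log_pos hx3
  set l := A * Real.log x / x with hl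
  have hl0 : 0 < l := by positivity
  have hFx : B * x ^ (-ρ) ≤ F x := by
    have h := hpot x₀ x (by linarith) hx2 hx2
    rw [Real.rpow_neg hx0.le, ← div_eq_mul_inv, div_le_iff₀ (by positivity), hB,
      div_le_iff₀ hC]
    linarith
  set K := ⌊(1 - δ) / m * x⌋₊ with hKdef
  have hd : 0 < 1 - δ := by linarith
  have hK : (K : ℝ) ≤ (1 - δ) / m * x := Nat.floor_le (by positivity)
  have hch := measureReal_le_sum_min_le hYm hY0 hYi hYd (by linarith) hp2 hint1 hintp hl0.le
    (mul_pos hη0 hx0).le K x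
  have hlx : l * x = A * Real.log x := by rw [hl]; field_simp
  have hlT : Real.exp (l * (η * x)) = x ^ s := by
    rw [Real.rpow_def_of_pos hx0]
    congr 1
    rw [hl, hη]
    field_simp
  have hlp : l ^ p * x * x ^ s = A ^ p * (Real.log x ^ p / x ^ s) := by
    have h2s : x ^ p = x * x ^ s * x ^ s := by
      nth_rewrite 2 [← Real.rpow_one x]
      rw [← Real.rpow_add hx0, ← Real.rpow_add hx0]
      congr 1
      rw [hs]; ring
    rw [hl, Real.div_rpow (by positivity) hx0.le, Real.mul_rpow hA0.le hlog.le, h2s]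
    field_simp
  -- The mean term cancels all but δlx of lx and the error is below 1, so the probability is at most
  -- e · x^(-ρ-1), against `F` ≥ B x^(-ρ).
  have hexp : -(l * x) + K * (l * m + l ^ p * M * Real.exp (l * (η * x))) ≤
      Real.log x * (-ρ - 1) + 1 := by
    have h1 : K * (l * m + l ^ p * M * Real.exp (l * (η * x))) ≤
        (1 - δ) / m * x * (l * m + l ^ p * M * Real.exp (l * (η * x))) := by gcongr
    have h2 : (1 - δ) / m * x * (l * m + l ^ p * M * Real.exp (l * (η * x))) =
        (1 - δ) * (l * x) + (1 - δ) / m * A ^ p * M * (Real.log x ^ p / x ^ s) := by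
      rw [hlT]
      calc _ = (1 - δ) * (l * x) * (m / m) + (1 - δ) / m * M * (l ^ p * x * x ^ s) := by ring
        _ = _ := by rw [hlp, div_self hm.ne']; ring
    have h3 : δ * (l * x) = (ρ + 1) * Real.log x := by
      rw [hlx, hA]; field_simp
    nlinarith
  have hnum := hch.trans (Real.exp_le_exp.2 hexp)
  rw [Real.exp_add, ← Real.rpow_def_of_pos hx0] at hnum
  calc _ ≤ x ^ (-ρ - 1) * Real.exp 1 / (B * x ^ (-ρ)) := by gcongr
    _ = _ := by
      rw [sub_eq_add_neg, Real.rpow_add hx0]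
      have : x ^ (-ρ) ≠ 0 := (Real.rpow_pos_of_pos hx0 _).ne'
      field_simp

theorem tendsto_measureReal_sum_le (hYm : ∀ i, Measurable (Y i)) (hYi : iIndepFun Y P)
    (hYd : ∀ i, IdentDistrib (Y i) (Y 0) P P) (hint : Integrable (Y 0) P)
    {a : ℝ} (ha : a < ∫ ω, Y 0 ω ∂P) :
    Tendsto (fun k : ℕ => P.real {ω | ∑ i ∈ Finset.range k, Y i ω ≤ a * k}) atTop (𝓝 0) := by
  set m := ∫ ω, Y 0 ω ∂P
  have hlln := strong_law_ae_real Y hint (fun i j hij => hYi.indepFun hij) hYd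
  have h1 := tendstoInMeasure_of_tendsto_ae (μ := P)
    (f := fun (n : ℕ) ω => (∑ i ∈ Finset.range n, Y i ω) / n) (g := fun _ => m)
    (fun n => by fun_prop) hlln
  rw [tendstoInMeasure_iff_measureReal_norm] at h1
  refine squeeze_zero' (Eventually.of_forall fun _ => measureReal_nonneg) ?_
    (h1 (m - a) (sub_pos.2 ha))
  filter_upwards [eventually_gt_atTop 0] with k hk
  refine measureReal_mono fun ω hω => ?_
  have hk' : (0 : ℝ) < k := by exact_mod_cast hk
  have h2 : (∑ i ∈ Finset.range k, Y i ω) / k ≤ a := (div_le_iff₀ hk').2 hω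
  show m - a ≤ ‖(∑ i ∈ Finset.range k, Y i ω) / k - m‖
  rw [Real.norm_eq_abs, abs_sub_comm]
  exact le_trans (by linarith) (le_abs_self _)

/-- Tail of a random sum with regularly varying number of summands. -/
theorem tendsto_tailProb_randomSum (hYm : ∀ i, Measurable (Y i))
    (hY0 : ∀ i ω, 0 ≤ Y i ω) (hYi : iIndepFun Y P) (hYd : ∀ i, IdentDistrib (Y i) (Y 0) P P)
    (hNY : IndepFun N (fun ω i => Y i ω) P)
    (hNr : RegularlyVaryingAtInfinity (tailProb P (fun ω => (N ω : ℝ))) (-γ))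
    (hr1 : 1 < r) (hrγ : γ < r) (hint : Integrable (fun ω => Y 0 ω ^ r) P)
    (hm : 0 < ∫ ω, Y 0 ω ∂P) :
    Tendsto (fun x => tailProb P (fun ω => ∑ i ∈ Finset.range (N ω), Y i ω) x /
      tailProb P (fun ω => (N ω : ℝ)) x) atTop (𝓝 ((∫ ω, Y 0 ω ∂P) ^ γ)) := by
  have hint1 : Integrable (Y 0) P := by
    simpa using integrable_rpow_of_le (hYm 0) (hY0 0) zero_le_one hr1.le hint
  set m := ∫ ω, Y 0 ω ∂P with hmdef
  set F := tailProb P (fun ω => (N ω : ℝ))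
  have hcont : Tendsto (fun t : ℝ => ((1 + t) / m) ^ (-γ)) (𝓝 0) (𝓝 (m ^ γ)) := by
    have h1 : ContinuousAt (fun t : ℝ => ((1 + t) / m) ^ (-γ)) 0 :=
      ContinuousAt.rpow_const (by fun_prop) (Or.inl (by simpa using hm.ne'))
    have h2 : ((1 + 0) / m) ^ (-γ) = m ^ γ := by
      rw [add_zero, one_div, Real.inv_rpow hm.le, Real.rpow_neg hm.le, inv_inv]
    rw [← h2]
    exact h1.tendsto
  rw [tendsto_order]
  constructor
  · intro b hb
    obtain ⟨δ, hδb, hδ0⟩ := (((hcont.mono_left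
      (nhdsWithin_le_nhds (s := Set.Ioi 0))).eventually_const_lt hb).and
      self_mem_nhdsWithin).exists
    replace hδ0 : 0 < δ := hδ0
    set c := (1 + δ) / m with hc
    have hc0 : 0 < c := by positivity
    have ha : m / (1 + δ) < m := div_lt_self hm (by linarith)
    -- For integer N, N > cx means N ≥ ⌊cx⌋ + 1; this deterministic number of summands already sums
    -- to more than x with probability tending to 1.
    have hk : Tendsto (fun x : ℝ => ⌊c * x⌋₊ + 1) atTop atTop :=
      tendsto_atTop_mono (fun x => Nat.le_succ _)
        (tendsto_nat_floor_atTop.comp (tendsto_id.const_mul_atTop hc0))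
    have h1 := (tendsto_measureReal_sum_le hYm hYi hYd hint1 ha).comp hk
    have h2 := (hNr.tendsto c hc0).mul (h1.const_sub 1)
    rw [sub_zero, mul_one] at h2
    filter_upwards [h2.eventually_const_lt hδb, eventually_gt_atTop 0] with x hx hx0
    refine hx.trans_le ?_
    have hFx := hNr.pos x hx0
    rw [div_mul_eq_mul_div]
    refine div_le_div_of_nonneg_right ?_ hFx.le
    simp only [Function.comp]
    set k := ⌊c * x⌋₊ + 1 with hkdef
    have hkx : c * x < k := by
      rw [hkdef]; push_cast; exact Nat.lt_floor_add_one _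
    have hE : MeasurableSet {ω | ∑ i ∈ Finset.range k, Y i ω ≤ m / (1 + δ) * k} :=
      measurableSet_le (by fun_prop) measurable_const
    rw [← probReal_compl_eq_one_sub hE]
    have hind : IndepFun N (fun ω => ∑ i ∈ Finset.range k, Y i ω) P :=
      hNY.comp measurable_id
        (show Measurable fun y : ℕ → ℝ => ∑ i ∈ Finset.range k, y i by fun_prop)
    have h3 := hind.measure_inter_preimage_eq_mul {n | c * x < (n : ℝ)}
      (Set.Ioi (m / (1 + δ) * k)) MeasurableSet.of_discrete measurableSet_Ioi
    have h4 : {ω | ∑ i ∈ Finset.range k, Y i ω ≤ m / (1 + δ) * k}ᶜ =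
        (fun ω => ∑ i ∈ Finset.range k, Y i ω) ⁻¹' (Set.Ioi (m / (1 + δ) * k)) := by
      ext ω; simp
    have h5 : F (c * x) * P.real {ω | ∑ i ∈ Finset.range k, Y i ω ≤ m / (1 + δ) * k}ᶜ =
        P.real ((N ⁻¹' {n | c * x < (n : ℝ)}) ∩
          (fun ω => ∑ i ∈ Finset.range k, Y i ω) ⁻¹' (Set.Ioi (m / (1 + δ) * k))) := by
      rw [h4, measureReal_def _ (_ ∩ _), h3, ENNReal.toReal_mul]
      rfl
    rw [h5]
    refine measureReal_mono ?_
    rintro ω ⟨hω1, hω2⟩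
    have hω1' : c * x < (N ω : ℝ) := hω1
    have hω2' : m / (1 + δ) * k < ∑ i ∈ Finset.range k, Y i ω := hω2
    have hkN : k ≤ N ω := 
      Nat.succ_le_of_lt ((Nat.floor_lt (by positivity)).2 hω1')
    have hsum : ∑ i ∈ Finset.range k, Y i ω ≤ ∑ i ∈ Finset.range (N ω), Y i ω :=
      Finset.sum_le_sum_of_subset_of_nonneg (Finset.range_mono hkN) fun i _ _ => hY0 i ω
    have hx' : x = m / (1 + δ) * (c * x) := by rw [hc]; field_simp
    show x < ∑ i ∈ Finset.range (N ω), Y i ω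
    calc x = m / (1 + δ) * (c * x) := hx'
      _ ≤ m / (1 + δ) * k := by gcongr
      _ < _ := hω2'.trans_le hsum
  · intro b hb
    obtain ⟨t, htb, ht1, ht0⟩ := (((hcont.mono_left
      (nhdsWithin_le_nhds (s := Set.Iio 0))).eventually_lt_const hb).and
      (Ioo_mem_nhdsLT (show (-1 : ℝ) < 0 by norm_num))).exists
    obtain ⟨δ, rfl⟩ : ∃ δ, t = -δ := ⟨-t, by ring⟩
    have hδ0 : 0 < δ := by linarith
    have hδ1 : δ < 1 := by linarith
    rw [← sub_eq_add_neg] at htb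
    have hc0 : 0 < (1 - δ) / m := div_pos (by linarith) hm
    obtain ⟨η, hη, hlim⟩ := tendsto_measureReal_le_sum_min_div hYm hY0 hYi hYd hNr
      tailProb_antitone tailProb_le_one hr1 hint hm hδ0 hδ1
    rw [← hmdef] at hlim
    set c := (1 - δ) / m with hc
    have h1 := ((hNr.tendsto c hc0).add (tendsto_measureReal_exists_lt_div hY0 hYd hNY hNr
      hr1 hrγ hint hc0 hη)).add hlim
    rw [add_zero, add_zero] at h1
    filter_upwards [h1.eventually_lt_const htb, eventually_gt_atTop 0] with x hx hx0
    refine lt_of_le_of_lt ?_ hx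
    have hFx := hNr.pos x hx0
    rw [← add_div, ← add_div]
    refine div_le_div_of_nonneg_right ?_ hFx.le
    have hsub : {ω | x < ∑ i ∈ Finset.range (N ω), Y i ω} ⊆
        ({ω | c * x < (N ω : ℝ)} ∪ {ω | (N ω : ℝ) ≤ c * x ∧ ∃ i < N ω, η * x < Y i ω}) ∪
        {ω | x ≤ ∑ i ∈ Finset.range ⌊c * x⌋₊, min (Y i ω) (η * x)} := by
      intro ω hω
      by_contra hcon
      simp only [Set.mem_union, Set.mem_ofPred_eq, not_or, not_lt, not_le, not_and,
        not_exists] at hcon hω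
      obtain ⟨⟨c1, c2⟩, c3⟩ := hcon
      have h2 : ∑ i ∈ Finset.range (N ω), Y i ω =
          ∑ i ∈ Finset.range (N ω), min (Y i ω) (η * x) :=
        Finset.sum_congr rfl fun i hi => (min_eq_left (c2 c1 i (Finset.mem_range.1 hi))).symm
      have h3 : ∑ i ∈ Finset.range (N ω), min (Y i ω) (η * x) ≤
          ∑ i ∈ Finset.range ⌊c * x⌋₊, min (Y i ω) (η * x) :=
        Finset.sum_le_sum_of_subset_of_nonneg (Finset.range_mono (Nat.le_floor c1))
          fun i _ _ => le_min (hY0 i ω) (mul_pos hη hx0).le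
      linarith
    refine (measureReal_mono hsub).trans ((measureReal_union_le _ _).trans ?_)
    gcongr
    exact measureReal_union_le _ _

end RandomSumTail

/-! ### Independence structure of the process and the induction over generations. -/

section GaltonWatson

/-- The σ-algebra is a free argument so that the lemma also applies to `gwiSigma`. -/
theorem measurable_sum_range_comp {Ω : Type*} {mΩ : MeasurableSpace Ω} {N : Ω → ℕ}
    {Y : ℕ → Ω → ℕ} (hN : Measurable N) (hY : ∀ i, Measurable (Y i)) :
    Measurable fun ω => ∑ i ∈ Finset.range (N ω), Y i ω := by
  have h : Measurable fun q : Ω × ℕ => ∑ i ∈ Finset.range q.2, Y i q.1 :=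
    measurable_from_prod_countable_left fun k =>
      (Finset.measurable_sum (Finset.range k) fun i _ => hY i :)
  exact h.comp (measurable_id.prodMk hN)

/-- The generation in which a variable of the family is used. -/
def GWILabel.generation : GWILabel → ℕ
  | .initial => 0
  | .offspring n _ => n + 1
  | .immigration n => n + 1

variable {Ω : Type*} {X : ℕ → Ω → ℕ} {ξ : ℕ → ℕ → Ω → ℕ} {ε : ℕ → Ω → ℕ}

/-- The σ-algebra generated by the variables with labels in `S`. -/
abbrev gwiSigma (X₀ : Ω → ℕ) (ξ : ℕ → ℕ → Ω → ℕ) (ε : ℕ → Ω → ℕ) (S : Set GWILabel) :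
    MeasurableSpace Ω :=
  ⨆ l ∈ S, MeasurableSpace.comap (gwiFamily X₀ ξ ε l) ⊤

theorem gwiSigma_mono {X₀ : Ω → ℕ} {S T : Set GWILabel} (h : S ⊆ T) :
    gwiSigma X₀ ξ ε S ≤ gwiSigma X₀ ξ ε T :=
  biSup_mono h

theorem measurable_gwiFamily_gwiSigma {X₀ : Ω → ℕ} {S : Set GWILabel} {l : GWILabel}
    (hl : l ∈ S) : Measurable[gwiSigma X₀ ξ ε S] (gwiFamily X₀ ξ ε l) := by
  rw [measurable_iff_comap_le]
  exact le_biSup (fun l => MeasurableSpace.comap (gwiFamily X₀ ξ ε l) ⊤) hl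

theorem measurable_gwiSigma_sum {n : ℕ} {S : Set GWILabel}
    (hn : Measurable[gwiSigma (X 0) ξ ε S] (X n)) (hS : ∀ i, GWILabel.offspring n i ∈ S) :
    Measurable[gwiSigma (X 0) ξ ε S]
      fun ω => ∑ i ∈ Finset.range (X n ω), ξ (n + 1) (i + 1) ω :=
  measurable_sum_range_comp hn fun i => measurable_gwiFamily_gwiSigma (hS i)

variable [MeasurableSpace Ω] {P : Measure Ω}

theorem IsGWI.indep_gwiSigma (hX : IsGWI P X ξ ε) {S T : Set GWILabel} (hST : Disjoint S T) :
    Indep (gwiSigma (X 0) ξ ε S) (gwiSigma (X 0) ξ ε T) P :=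
  indep_iSup_of_disjoint (fun l => (hX.measurable l).comap_le) hX.indep.iIndep hST

theorem IsGWI.indepFun_of_measurable (hX : IsGWI P X ξ ε) {S T : Set GWILabel}
    (hST : Disjoint S T) {α β : Type*} [MeasurableSpace α] [MeasurableSpace β] {f : Ω → α}
    {g : Ω → β} (hf : Measurable[gwiSigma (X 0) ξ ε S] f)
    (hg : Measurable[gwiSigma (X 0) ξ ε T] g) : IndepFun f g P :=
  (IndepFun_iff_Indep f g P).2
    (indep_of_indep_of_le (hX.indep_gwiSigma hST) hf.comap_le hg.comap_le)

theorem IsGWI.recursion_range (hX : IsGWI P X ξ ε) (n : ℕ) (ω : Ω) :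
    X (n + 1) ω = (∑ i ∈ Finset.range (X n ω), ξ (n + 1) (i + 1) ω) + ε (n + 1) ω := by
  rw [hX.recursion (n + 1) (by omega) ω, Nat.add_sub_cancel, Finset.range_eq_Ico,
    Finset.sum_Ico_add' (fun i => ξ (n + 1) i ω) 0 (X n ω) 1]
  rfl

theorem IsGWI.measurable_gwiSigma (hX : IsGWI P X ξ ε) (n : ℕ) :
    Measurable[gwiSigma (X 0) ξ ε {l | l.generation ≤ n}] (X n) := by
  induction n with
  | zero => exact measurable_gwiFamily_gwiSigma (l := .initial) (le_refl 0)
  | succ n ih =>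
    have h1 : Measurable[gwiSigma (X 0) ξ ε {l | l.generation ≤ n + 1}] (X n) :=
      ih.mono (gwiSigma_mono fun l (hl : _ ≤ n) => Nat.le_succ_of_le hl) le_rfl
    have h2 := measurable_gwiSigma_sum h1 fun i => le_refl (n + 1)
    have h3 : Measurable[gwiSigma (X 0) ξ ε {l | l.generation ≤ n + 1}] (ε (n + 1)) :=
      measurable_gwiFamily_gwiSigma (l := .immigration n) (le_refl (n + 1))
    rw [funext (hX.recursion_range n)]
    exact h2.add h3

theorem IsGWI.measurable_process (hX : IsGWI P X ξ ε) (n : ℕ) : Measurable (X n) :=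
  (hX.measurable_gwiSigma n).mono (iSup₂_le fun l _ => (hX.measurable l).comap_le) le_rfl

/-- `X n` uses only labels of generation at most n, whereas these offspring have generation n + 1.
-/
theorem IsGWI.indepFun_offspring (hX : IsGWI P X ξ ε) (n : ℕ) :
    IndepFun (X n) (fun ω i => (ξ (n + 1) (i + 1) ω : ℝ)) P := by
  refine hX.indepFun_of_measurable (T := {l | n < l.generation}) ?_ (hX.measurable_gwiSigma n) ?_
  · exact Set.disjoint_left.2 fun l h1 h2 => not_lt_of_ge (α := ℕ) h1 h2
  · refine @measurable_pi_lambda Ω ℕ _ (gwiSigma (X 0) ξ ε {l | n < l.generation}) _ _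
      fun i => ?_
    exact (measurable_from_top (f := fun k : ℕ => (k : ℝ))).comp
      (measurable_gwiFamily_gwiSigma (l := .offspring n i) (Nat.lt_succ_self n))

/-- The sum involves neither `ε (n + 1)` nor anything built from it, so splitting off that single
label suffices. -/
theorem IsGWI.indepFun_immigration (hX : IsGWI P X ξ ε) (n : ℕ) :
    IndepFun (fun ω => ∑ i ∈ Finset.range (X n ω), ξ (n + 1) (i + 1) ω) (ε (n + 1)) P := by
  refine hX.indepFun_of_measurable (S := {.immigration n}ᶜ) (T := {.immigration n})
    disjoint_compl_left ?_ (measurable_gwiFamily_gwiSigma (l := .immigration n) rfl)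
  refine measurable_gwiSigma_sum ((hX.measurable_gwiSigma n).mono (gwiSigma_mono ?_) le_rfl)
    fun i => by simp
  rintro l hl rfl
  exact absurd hl (Nat.not_succ_le_self n)

variable [IsProbabilityMeasure P]

/-- One step of the recursion: tail of the next generation. -/
theorem IsGWI.tendsto_tailProb_succ (hX : IsGWI P X ξ ε) {γ r : ℝ} (hγ : 0 ≤ γ)
    (hε : IsRegularlyVaryingRV P (fun ω => (ε 1 ω : ℝ)) γ) (hr1 : 1 < r) (hrγ : γ < r)
    (hint : Integrable (fun ω => (ξ 1 1 ω : ℝ) ^ r) P) (hm : 0 < ∫ ω, (ξ 1 1 ω : ℝ) ∂P) (n : ℕ)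
    (hn : IsRegularlyVaryingRV P (fun ω => (X n ω : ℝ)) γ) :
    Tendsto (fun x => tailProb P (fun ω => (X (n + 1) ω : ℝ)) x /
      ((∫ ω, (ξ 1 1 ω : ℝ) ∂P) ^ γ * tailProb P (fun ω => (X n ω : ℝ)) x +
        tailProb P (fun ω => (ε 1 ω : ℝ)) x)) atTop (𝓝 1) := by
  set m := ∫ ω, (ξ 1 1 ω : ℝ) ∂P
  have hcast : Measurable fun k : ℕ => (k : ℝ) := measurable_from_top
  set Y : ℕ → Ω → ℝ := fun i ω => (ξ (n + 1) (i + 1) ω : ℝ) with hY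
  have hYm : ∀ i, Measurable (Y i) := fun i => hcast.comp (hX.measurable (.offspring n i))
  have hYi : iIndepFun Y P := by
    have h1 : iIndepFun (fun i => gwiFamily (X 0) ξ ε (.offspring n i)) P :=
      hX.indep.precomp (g := fun i => GWILabel.offspring n i) fun i j h => by
        simpa using h
    exact h1.comp (fun _ k => (k : ℝ)) fun _ => hcast
  have hY1 : ∀ i, IdentDistrib (Y i) (fun ω => (ξ 1 1 ω : ℝ)) P P := fun i =>
    (hX.identDistrib_offspring (n + 1) (i + 1) (by omega) (by omega)).comp hcast
  have hmean : ∫ ω, Y 0 ω ∂P = m := (hY1 0).integral_eq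
  have hintY : Integrable (fun ω => Y 0 ω ^ r) P :=
    ((hY1 0).comp (u := fun y : ℝ => y ^ r) (by fun_prop)).integrable_iff.2 hint
  have hS := tendsto_tailProb_randomSum hYm
    (fun i ω => Nat.cast_nonneg _) hYi (fun i => (hY1 i).trans (hY1 0).symm)
    (hX.indepFun_offspring n) hn.tail hr1 hrγ hintY (by rwa [hmean])
  rw [hmean] at hS
  set S : Ω → ℝ := fun ω => ∑ i ∈ Finset.range (X n ω), Y i ω with hSdef
  have hScast : S = fun ω => ((∑ i ∈ Finset.range (X n ω), ξ (n + 1) (i + 1) ω : ℕ) : ℝ) := by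
    funext ω; simp [hSdef, hY]
  have hSm : Measurable S := by
    rw [hScast]
    exact hcast.comp (measurable_sum_range_comp (hX.measurable_process n)
      fun i => hX.measurable (.offspring n i))
  have hmγ : 0 < m ^ γ := Real.rpow_pos_of_pos hm γ
  have hU := hn.tail.const_mul hmγ
  have hS1 : Tendsto (fun x => tailProb P S x / (m ^ γ * tailProb P (fun ω => (X n ω : ℝ)) x))
      atTop (𝓝 1) := by
    have := hS.div_const (m ^ γ)
    rw [div_self hmγ.ne'] at this
    refine this.congr fun x => ?_
    rw [div_div, mul_comm]
  have hSr : IsRegularlyVaryingRV P S γ :=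
    .of_tendsto_div hγ hSm (fun ω => Finset.sum_nonneg fun i _ => Nat.cast_nonneg _) hU hS1
  have hεd : IdentDistrib (fun ω => (ε (n + 1) ω : ℝ)) (fun ω => (ε 1 ω : ℝ)) P P :=
    (hX.identDistrib_immigration (n + 1) (by omega)).comp hcast
  have hεt : tailProb P (fun ω => (ε (n + 1) ω : ℝ)) = tailProb P (fun ω => (ε 1 ω : ℝ)) :=
    funext fun x => congrArg ENNReal.toReal (hεd.measure_mem_eq (measurableSet_Ioi (a := x)))
  have hεn : IsRegularlyVaryingRV P (fun ω => (ε (n + 1) ω : ℝ)) γ :=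
    ⟨hcast.comp (hX.measurable (.immigration n)), fun ω => Nat.cast_nonneg _, hγ,
      hεt ▸ hε.tail⟩
  have hind : IndepFun S (fun ω => (ε (n + 1) ω : ℝ)) P := by
    rw [hScast]
    exact (hX.indepFun_immigration n).comp hcast hcast
  have hadd := hSr.tendsto_tailProb_add hεn hind
  have hrec : (fun ω => S ω + (ε (n + 1) ω : ℝ)) = fun ω => (X (n + 1) ω : ℝ) := by
    funext ω
    rw [hX.recursion_range n ω, hScast]
    push_cast
    rfl
  rw [hrec, hεt] at hadd
  have hself : Tendsto (fun x => tailProb P (fun ω => (ε 1 ω : ℝ)) x /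
      tailProb P (fun ω => (ε 1 ω : ℝ)) x) atTop (𝓝 1) :=
    tendsto_const_nhds.congr' (hε.tail.eventually_pos.mono fun x hx => (div_self hx.ne').symm)
  have hmed := tendsto_add_div_add hU.eventually_pos hε.tail.eventually_pos hS1 hself
  simpa using tendsto_div_trans (hSr.tail.add hε.tail).eventually_pos hadd hmed

/-- The induction starts at 0, where the sum is empty and the ratio is eventually 1. Regular
variation is carried along because the one-step result requires it. -/
theorem IsGWI.tendsto_tailProb (hX : IsGWI P X ξ ε) {γ r : ℝ} (hγ : 0 ≤ γ)
    (hX₀ : IsRegularlyVaryingRV P (fun ω => (X 0 ω : ℝ)) γ)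
    (hε : IsRegularlyVaryingRV P (fun ω => (ε 1 ω : ℝ)) γ) (hr1 : 1 < r) (hrγ : γ < r)
    (hint : Integrable (fun ω => (ξ 1 1 ω : ℝ) ^ r) P) {m : ℝ} (hm : 0 < m)
    (hmean : m = ∫ ω, (ξ 1 1 ω : ℝ) ∂P) (n : ℕ) :
    Tendsto
        (fun x : ℝ =>
          tailProb P (fun ω => (X n ω : ℝ)) x /
            (m ^ ((n : ℝ) * γ) * tailProb P (fun ω => (X 0 ω : ℝ)) x
              + ∑ i ∈ Finset.Icc 1 n,
                  m ^ (((n : ℝ) - (i : ℝ)) * γ) * tailProb P (fun ω => (ε 1 ω : ℝ)) x))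
        atTop (𝓝 1) ∧
      IsRegularlyVaryingRV P (fun ω => (X n ω : ℝ)) γ := by
  have hmγ : 0 < m ^ γ := Real.rpow_pos_of_pos hm γ
  induction n with
  | zero =>
    refine ⟨?_, hX₀⟩
    refine tendsto_const_nhds.congr' (hX₀.tail.eventually_pos.mono fun x hx => ?_)
    simp [div_self hx.ne']
  | succ n ih =>
    obtain ⟨ih1, ih2⟩ := ih
    have hstep := hX.tendsto_tailProb_succ hγ hε hr1 hrγ hint (hmean ▸ hm) n ih2
    rw [← hmean] at hstep
    have hUn := (ih2.tail.const_mul hmγ).add hε.tail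
    refine ⟨?_, .of_tendsto_div hγ (measurable_from_top.comp (hX.measurable_process (n + 1)))
      (fun ω => Nat.cast_nonneg _) hUn hstep⟩
    set a : ℝ → ℝ := fun x => m ^ ((n : ℝ) * γ) * tailProb P (fun ω => (X 0 ω : ℝ)) x
              + ∑ i ∈ Finset.Icc 1 n,
                  m ^ (((n : ℝ) - (i : ℝ)) * γ) * tailProb P (fun ω => (ε 1 ω : ℝ)) x with ha
    have ha0 : ∀ᶠ x in atTop, 0 < m ^ γ * a x := by
      filter_upwards [hX₀.tail.eventually_pos] with x hx
      have h1 := tailProb_nonneg (P := P) (Z := fun ω => (ε 1 ω : ℝ)) x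
      have h2 : 0 ≤ ∑ i ∈ Finset.Icc 1 n,
          m ^ (((n : ℝ) - (i : ℝ)) * γ) * tailProb P (fun ω => (ε 1 ω : ℝ)) x :=
        Finset.sum_nonneg fun i _ => by positivity
      positivity
    have h1 : Tendsto (fun x => m ^ γ * tailProb P (fun ω => (X n ω : ℝ)) x / (m ^ γ * a x))
        atTop (𝓝 1) := by
      simpa [mul_div_mul_left _ _ hmγ.ne'] using ih1
    have hself : Tendsto (fun x => tailProb P (fun ω => (ε 1 ω : ℝ)) x /
        tailProb P (fun ω => (ε 1 ω : ℝ)) x) atTop (𝓝 1) :=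
      tendsto_const_nhds.congr' (hε.tail.eventually_pos.mono fun x hx => (div_self hx.ne').symm)
    have hmed := tendsto_add_div_add ha0 hε.tail.eventually_pos h1 hself
    have h2 := tendsto_div_trans hUn.eventually_pos hstep hmed
    rw [one_mul] at h2
    refine h2.congr fun x => ?_
    congr 1
    -- Multiplying by m^γ raises every exponent by γ; the new immigration term is the summand i = n
    -- + 1, with exponent 0.
    have hpow : ∀ t : ℝ, m ^ γ * m ^ (t * γ) = m ^ ((t + 1) * γ) := fun t => by
      rw [← Real.rpow_add hm]; ring_nf
    rw [Finset.sum_Icc_succ_top (by omega), ha]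
    simp only [mul_add, Finset.mul_sum, ← mul_assoc, hpow]
    push_cast
    simp only [sub_self, zero_mul, Real.rpow_zero, one_mul, sub_add_eq_add_sub, add_assoc]

end GaltonWatson

theorem mainTheorem6 {Ω : Type*} [MeasurableSpace Ω] (P : Measure Ω) [IsProbabilityMeasure P]
    (X : ℕ → Ω → ℕ) (ξ : ℕ → ℕ → Ω → ℕ) (ε : ℕ → Ω → ℕ) (hX : IsGWI P X ξ ε)
    (γ : ℝ) (hγ : 0 ≤ γ)
    (hX₀ : IsRegularlyVaryingRV P (fun ω => (X 0 ω : ℝ)) γ)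
    (hε : IsRegularlyVaryingRV P (fun ω => (ε 1 ω : ℝ)) γ)
    (hξ₀ : P {ω | ξ 1 1 ω = 0} < 1)
    (hξ : ∃ r : ℝ, max 1 γ < r ∧ Integrable (fun ω => (ξ 1 1 ω : ℝ) ^ r) P)
    (m : ℝ) (hm : m = ∫ ω, (ξ 1 1 ω : ℝ) ∂P) :
    ∀ n : ℕ, 1 ≤ n →
      Tendsto
        (fun x : ℝ =>
          tailProb P (fun ω => (X n ω : ℝ)) x /
            (m ^ ((n : ℝ) * γ) * tailProb P (fun ω => (X 0 ω : ℝ)) x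
              + ∑ i ∈ Finset.Icc 1 n,
                  m ^ (((n : ℝ) - (i : ℝ)) * γ) * tailProb P (fun ω => (ε 1 ω : ℝ)) x))
        atTop (𝓝 1) ∧
      IsRegularlyVaryingRV P (fun ω => (X n ω : ℝ)) γ := by
  intro n _
  obtain ⟨r, hr, hint⟩ := hξ
  obtain ⟨hr1, hrγ⟩ := max_lt_iff.1 hr
  have hξm : Measurable (fun ω => (ξ 1 1 ω : ℝ)) :=
    measurable_from_top.comp (hX.measurable (.offspring 0 0))
  have hξ0 : ∀ ω, 0 ≤ (ξ 1 1 ω : ℝ) := fun ω => Nat.cast_nonneg _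
  have hint1 : Integrable (fun ω => (ξ 1 1 ω : ℝ)) P := by
    simpa using integrable_rpow_of_le hξm hξ0 zero_le_one hr1.le hint
  -- A non-negative variable of mean zero vanishes almost surely, contrary to P(ξ = 0) < 1.
  have hmpos : 0 < m := by
    refine hm ▸ lt_of_le_of_ne (integral_nonneg hξ0) fun h => hξ₀.ne ?_
    have h0 := (integral_eq_zero_iff_of_nonneg hξ0 hint1).1 h.symm
    refine (measure_congr (eventuallyEq_univ.2 ?_)).trans measure_univ
    filter_upwards [h0] with ω hω
    simpa using hω
  exact hX.tendsto_tailProb hγ hX₀ hε hr1 hrγ hint hmpos hm n
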